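/- Let $n\ge 4$ be an integer, let $F_n$ be the free group with basis $a_1,\dots,a_n$, and for $1\le i\ne j\le n$ let the Nielsen transformations $\rho_{ij},\lambda_{ij}\in\mathrm{Aut}(F_n)$ be given by $$\rho_{ij}\colon a_i\mapsto a_ia_j,\quad a_k\mapsto a_k\ (k\ne i),\qquad \lambda_{ij}\colon a_i\mapsto a_ja_i,\quad a_k\mapsto a_k\ (k\neq i).$$ Let $X$ be a nonempty complete $\mathrm{CAT}(0)$ space of finite covering dimension $d<n-2$, and let $\mathrm{Aut}(F_n)$ act on $X$ by isometries (the isometries are not assumed to be semisimple). Then every Nielsen transformation $\rho_{ij}$ and $\lambda_{ij}$ ($i\neq j$) has a fixed point in $X$. -/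

import Mathlib

/-! ### CAT(0) spaces -/

/-- `γ`, restricted to `[0, 1]`, is a geodesic segment from `x` to `y`, parametrised
proportionally to arc length. -/
structure IsGeodesicSegment {X : Type*} [MetricSpace X] (γ : ℝ → X) (x y : X) : Prop where
  source : γ 0 = x
  target : γ 1 = y
  dist_eq : ∀ s ∈ Set.Icc (0 : ℝ) 1, ∀ t ∈ Set.Icc (0 : ℝ) 1,
    dist (γ s) (γ t) = |s - t| * dist x y

/-- A CAT(0) space: a geodesic metric space in which every geodesic triangle is at least as thin
as its comparison triangle in the Euclidean plane. The triangle has vertices `p 0, p 1, p 2` and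
sides `σ i` from `p i` to `p (i + 1)` (indices mod 3); the comparison triangle has vertices
`q 0, q 1, q 2`, and the comparison point of `σ i s` is the point of the segment
`[q i, q (i + 1)]` at the same parameter `s`. -/
structure IsCAT0 (X : Type*) [MetricSpace X] : Prop where
  exists_geodesic : ∀ x y : X, ∃ γ : ℝ → X, IsGeodesicSegment γ x y
  comparison : ∀ (p : Fin 3 → X) (σ : Fin 3 → ℝ → X)
    (q : Fin 3 → EuclideanSpace ℝ (Fin 2)),
    (∀ i, IsGeodesicSegment (σ i) (p i) (p (i + 1))) →
    (∀ i, dist (q i) (q (i + 1)) = dist (p i) (p (i + 1))) →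
    ∀ (i j : Fin 3), ∀ s ∈ Set.Icc (0 : ℝ) 1, ∀ t ∈ Set.Icc (0 : ℝ) 1,
      dist (σ i s) (σ j t) ≤
        dist (AffineMap.lineMap (q i) (q (i + 1)) s : EuclideanSpace ℝ (Fin 2))
          (AffineMap.lineMap (q j) (q (j + 1)) t)

/-! ### Covering dimension -/

/-- Covering dimension less than `k`: every finite open cover of `X` has a finite open refinement
(again a cover) such that every point lies in at most `k` of its members. -/
def HasCoveringDimensionLT (X : Type*) [TopologicalSpace X] (k : ℕ) : Prop :=
  ∀ 𝒰 : Set (Set X), 𝒰.Finite → (∀ U ∈ 𝒰, IsOpen U) → ⋃₀ 𝒰 = Set.univ →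
    ∃ 𝒱 : Set (Set X), 𝒱.Finite ∧ (∀ V ∈ 𝒱, IsOpen V) ∧ ⋃₀ 𝒱 = Set.univ ∧
      (∀ V ∈ 𝒱, ∃ U ∈ 𝒰, V ⊆ U) ∧ ∀ x : X, {V ∈ 𝒱 | x ∈ V}.encard ≤ k

theorem HasCoveringDimensionLT.mono {X : Type*} [TopologicalSpace X] {k l : ℕ} (hkl : k ≤ l)
    (h : HasCoveringDimensionLT X k) : HasCoveringDimensionLT X l := by
  intro 𝒰 h1 h2 h3
  obtain ⟨𝒱, a, b, c, d, e⟩ := h 𝒰 h1 h2 h3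
  exact ⟨𝒱, a, b, c, d, fun x => (e x).trans (by exact_mod_cast hkl)⟩

/-- The (Lebesgue) covering dimension of a topological space: `⊥` (that is, `-1`) for the empty
space, `⊤` (that is, `∞`) if no finite bound exists. -/
noncomputable def coveringDimension (X : Type*) [TopologicalSpace X] : WithBot ℕ∞ :=
  sInf {m | ∀ k : ℕ, m < k → HasCoveringDimensionLT X k}

theorem coveringDimension_le_iff {X : Type*} [TopologicalSpace X] {d : ℕ} :
    coveringDimension X ≤ d ↔ HasCoveringDimensionLT X (d + 1) := by
  constructor
  · intro h
    have h' : coveringDimension X < ((d + 1 : ℕ) : WithBot ℕ∞) :=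
      h.trans_lt (by exact_mod_cast d.lt_add_one)
    obtain ⟨m, hm, hlt⟩ := sInf_lt_iff.1 h'
    exact hm _ hlt
  · intro h
    exact sInf_le fun k hk => h.mono (by exact_mod_cast hk)

/-! ### Nielsen transformations of a free group -/

/-- The Nielsen transformation `ρ i j`: `a i ↦ a i * a j`, and `a k ↦ a k` for `k ≠ i`. -/
def nielsenRho {n : ℕ} (i j : Fin n) (hij : i ≠ j) : MulAut (FreeGroup (Fin n)) :=
  MonoidHom.toMulEquiv
    (FreeGroup.lift fun k =>
      if k = i then FreeGroup.of i * FreeGroup.of j else FreeGroup.of k)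
    (FreeGroup.lift fun k =>
      if k = i then FreeGroup.of i * (FreeGroup.of j)⁻¹ else FreeGroup.of k)
    (by
      ext k
      by_cases hk : k = i <;> simp [hk, hij.symm])
    (by
      ext k
      by_cases hk : k = i <;> simp [hk, hij.symm])

/-- The Nielsen transformation `lam i j`: `a i ↦ a j * a i`, and `a k ↦ a k` for `k ≠ i`. -/
def nielsenLambda {n : ℕ} (i j : Fin n) (hij : i ≠ j) : MulAut (FreeGroup (Fin n)) :=
  MonoidHom.toMulEquiv
    (FreeGroup.lift fun k =>
      if k = i then FreeGroup.of j * FreeGroup.of i else FreeGroup.of k)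
    (FreeGroup.lift fun k =>
      if k = i then (FreeGroup.of j)⁻¹ * FreeGroup.of i else FreeGroup.of k)
    (by
      ext k
      by_cases hk : k = i <;> simp [hk, hij.symm])
    (by
      ext k
      by_cases hk : k = i <;> simp [hk, hij.symm])

/-! Write `n = k + 1` and fix a generator `z`. The automorphisms `a_c ↦ z ^ u c * a_c * z ^ v c` (`c
≠ z`) commute, and in an action on a complete CAT(0) space commuting elements with fixed points have
a product with a fixed point. So the pairs `(u, v)` whose automorphism has a fixed point form a
group (`fixedVectors`), and it must contain `(0, e_i)` and `(e_i, 0)`.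

The source of fixed points is an affine Coxeter group of type A. The symmetric group permutes the
`n` points `1` and `a_c` (`c ≠ z`), renormalised by left multiplication; with right multiplication
of the points by powers of `z` this gives an action of `ℤ ^ n ⋊ S_n`. Each `k` of the `k + 1` simple
reflections share a fixed point. Fixed-point sets are closed and convex, so in dimension less than
`k` Helly's theorem (`IsCAT0.helly`) makes all of them meet, and the translations `e_i - e_j` have
fixed points. Conjugating by inversions of generators and combining the resulting vectors yields a
positive power of each Nielsen transformation, and a root of an element with a fixed point has one
too.

Helly's theorem comes from Kuhn's lemma: without a common point, the complements cover the space,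
and a singular simplex built by geodesic coning would meet `k + 1` members of a refinement of
multiplicity at most `k`. -/

/-! ### Kuhn's cubical Sperner lemma -/

namespace Kuhn

/-- The labelling determinant modulo `2`; it is nonzero only if all labels `0, …, m` occur. -/
def labelDet {m : ℕ} (h : Fin (m + 1) → ℕ) : ZMod 2 :=
  (Matrix.of fun (l i : Fin (m + 1)) => if h i = l then (1 : ZMod 2) else 0).det

theorem labelDet_eq_zero {m : ℕ} {h : Fin (m + 1) → ℕ} {l : ℕ} (hl : l ≤ m)
    (hne : ∀ i, h i ≠ l) : labelDet h = 0 :=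
  Matrix.det_eq_zero_of_row_eq_zero ⟨l, Nat.lt_succ_of_le hl⟩ fun i => by simp [hne i]

/-- Every column has exactly one entry `1`, so adding all rows to the last one turns it into a row
of ones. Expansion along it gives the facets, and signs vanish modulo `2`. -/
theorem labelDet_succ {m : ℕ} {h : Fin (m + 2) → ℕ} (hle : ∀ i, h i ≤ m + 1) :
    labelDet h = ∑ j : Fin (m + 2), labelDet fun i => h (j.succAbove i) := by
  set M : Matrix (Fin (m + 2)) (Fin (m + 2)) (ZMod 2) :=
    Matrix.of fun l i => if h i = l then (1 : ZMod 2) else 0 with hM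
  have h1 := Matrix.det_updateRow_sum M (Fin.last (m + 1)) (fun _ => 1)
  have h2 : (∑ k, (1 : ZMod 2) • M k) = fun _ => 1 := by
    funext i
    rw [Finset.sum_apply, Finset.sum_eq_single (⟨h i, by have := hle i; omega⟩ : Fin (m + 2))]
    · simp [hM]
    · intro b _ hb
      have : h i ≠ b := fun hc => hb (Fin.ext hc.symm)
      simp [hM, this]
    · simp
  rw [h2, one_smul] at h1
  change M.det = _
  rw [← h1, Matrix.det_succ_row _ (Fin.last (m + 1))]
  refine Finset.sum_congr rfl fun j _ => ?_
  have h3 : ((-1 : ZMod 2)) = 1 := by decide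
  rw [h3, one_pow, one_mul, Matrix.updateRow_self, one_mul]
  unfold labelDet
  congr 1
  ext l i
  simp [Matrix.submatrix_apply, hM, Matrix.updateRow_apply, (Fin.castSucc_lt_last l).ne]

/-- The vertices of the Kuhn simplex with lowest vertex `b` and order of coordinates `π`. -/
def vtx {m : ℕ} (b : Fin m → ℕ) (π : Equiv.Perm (Fin m)) (j : Fin (m + 1)) : Fin m → ℕ :=
  fun c => b c + if (j : ℕ) ≤ π c then 1 else 0

/-- The vertices of the grid cube with `N ^ m` cells that are lowest vertices of a cell. -/
def box (m N : ℕ) : Finset (Fin m → ℕ) := Fintype.piFinset fun _ => Finset.range N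

theorem mem_box {m N : ℕ} {b : Fin m → ℕ} : b ∈ box m N ↔ ∀ c, b c < N := by
  simp [box, Fintype.mem_piFinset]

theorem vtx_le {m N : ℕ} {b : Fin m → ℕ} (hb : b ∈ box m N) (π : Equiv.Perm (Fin m))
    (j : Fin (m + 1)) (c : Fin m) : vtx b π j c ≤ N := by
  have := mem_box.1 hb c
  unfold vtx
  split_ifs <;> omega

/-- A telescoping sum in direction `c`: modulo `2` the interior layers cancel and the layer `b c =
N` vanishes by assumption. -/
theorem sum_box_shift {m N : ℕ} (c : Fin m) (F : (Fin m → ℕ) → ZMod 2)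
    (hN : ∀ b : Fin m → ℕ, b c = N → (∀ x, x ≠ c → b x < N) → F b = 0) :
    ∑ b ∈ box m N, F (b + Pi.single c 1) + ∑ b ∈ box m N, F b =
      ∑ b ∈ (box m N).filter (fun b => b c = 0), F b := by
  classical
  have h1 : ∑ b ∈ box m N, F (b + Pi.single c 1) =
      ∑ b ∈ (box m N).filter (fun b => b c + 1 < N), F (b + Pi.single c 1) := by
    symm
    apply Finset.sum_subset (Finset.filter_subset _ _)
    intro b hb hb'
    have hb1 := mem_box.1 hb
    have hbc : b c + 1 = N := by
      have := hb1 c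
      simp only [Finset.mem_filter, hb, true_and] at hb'
      omega
    apply hN
    · simp [hbc]
    · intro x hx
      simp [hx, hb1 x]
  have h2 : ∑ b ∈ (box m N).filter (fun b => b c + 1 < N), F (b + Pi.single c 1) =
      ∑ b ∈ (box m N).filter (fun b => ¬ b c = 0), F b := by
    refine Finset.sum_bij' (fun b _ => b + Pi.single c 1) (fun b _ => b - Pi.single c 1)
      ?_ ?_ ?_ ?_ ?_
    · intro b hb
      simp only [Finset.mem_filter, mem_box] at hb ⊢
      refine ⟨fun x => ?_, by simp⟩
      by_cases hx : x = c
      · subst hx; simpa using hb.2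
      · simp [hx, hb.1 x]
    · intro b hb
      simp only [Finset.mem_filter, mem_box] at hb ⊢
      refine ⟨fun x => lt_of_le_of_lt (Nat.sub_le _ _) (hb.1 x), ?_⟩
      have := hb.1 c
      simp only [Pi.sub_apply, Pi.single_eq_same]
      omega
    · intro b _
      simp
    · intro b hb
      simp only [Finset.mem_filter] at hb
      funext x
      by_cases hx : x = c
      · subst hx
        simp only [Pi.add_apply, Pi.sub_apply, Pi.single_eq_same]
        omega
      · simp [hx]
    · intro b _; rfl
  rw [h1, h2, ← Finset.sum_filter_add_sum_filter_not (box m N) (fun b => b c = 0) F,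
    add_comm, add_assoc, CharTwo.add_self_eq_zero, add_zero]

/-- Kuhn's boundary conditions; the coordinate `c` corresponds to the label `m - c`. -/
structure IsLabelling {m : ℕ} (N : ℕ) (lab : (Fin m → ℕ) → ℕ) : Prop where
  le : ∀ v, (∀ c, v c ≤ N) → lab v ≤ m
  zero : ∀ v, (∀ c, v c ≤ N) → ∀ c : Fin m, v c = 0 → lab v ≠ m - (c : ℕ)
  top : ∀ v, (∀ c, v c ≤ N) → ∀ c : Fin m, v c = N → m - (c : ℕ) ≤ lab v

/-- On this face the top label is excluded, and the index shift preserves the label attached to each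
remaining coordinate. This permits induction on the dimension. -/
theorem IsLabelling.cons {m N : ℕ} {lab : (Fin (m + 1) → ℕ) → ℕ} (h : IsLabelling N lab) :
    IsLabelling N fun v : Fin m → ℕ => lab (Fin.cons 0 v) := by
  have key : ∀ v : Fin m → ℕ, (∀ c, v c ≤ N) →
      ∀ c, (Fin.cons 0 v : Fin (m + 1) → ℕ) c ≤ N := by
    intro v hv c
    refine Fin.cases ?_ (fun c => ?_) c
    · simp
    · simpa using hv c
  refine ⟨fun v hv => ?_, fun v hv c hc => ?_, fun v hv c hc => ?_⟩
  · have h1 := h.le _ (key v hv)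
    have h2 := h.zero _ (key v hv) 0 (by simp)
    simp only [Fin.val_zero] at h2
    omega
  · have h2 := h.zero _ (key v hv) c.succ (by simpa using hc)
    simpa using h2
  · have h2 := h.top _ (key v hv) c.succ (by simpa using hc)
    simpa using h2

/-- Without its vertex `j + 1`, a simplex does not see in which order two consecutive coordinates
change. Exchanging them pairs off the simplices of a cell. -/
theorem sum_facet_middle {m : ℕ} (lab : (Fin (m + 1) → ℕ) → ℕ) (b : Fin (m + 1) → ℕ)
    (j : Fin m) :
    ∑ π : Equiv.Perm (Fin (m + 1)),
      labelDet (fun i => lab (vtx b π ((j.succ.castSucc).succAbove i))) = 0 := by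
  refine Finset.sum_involution
    (fun π _ => Equiv.swap j.castSucc j.succ * π) ?_ ?_ (fun _ _ => Finset.mem_univ _) ?_
  · intro π _
    have : ∀ i, vtx b (Equiv.swap j.castSucc j.succ * π) ((j.succ.castSucc).succAbove i) =
        vtx b π ((j.succ.castSucc).succAbove i) := by
      intro i
      funext c
      have hi : (((j.succ.castSucc).succAbove i : Fin (m + 2)) : ℕ) ≠ j + 1 := by
        intro hc
        exact Fin.succAbove_ne (j.succ.castSucc) i (Fin.ext (by simpa using hc))
      unfold vtx
      rw [Equiv.Perm.mul_apply]
      rcases eq_or_ne (π c) j.castSucc with h1 | h1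
      · rw [h1, Equiv.swap_apply_left]
        simp only [Fin.val_succ, Fin.val_castSucc]
        congr 1
        have : ((((j.succ.castSucc).succAbove i : Fin (m + 2)) : ℕ) ≤ j + 1) ↔
          ((((j.succ.castSucc).succAbove i : Fin (m + 2)) : ℕ) ≤ j) := by omega
        simp only [this]
      · rcases eq_or_ne (π c) j.succ with h2 | h2
        · rw [h2, Equiv.swap_apply_right]
          simp only [Fin.val_succ, Fin.val_castSucc]
          congr 1
          have : ((((j.succ.castSucc).succAbove i : Fin (m + 2)) : ℕ) ≤ j + 1) ↔
            ((((j.succ.castSucc).succAbove i : Fin (m + 2)) : ℕ) ≤ j) := by omega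
          simp only [this]
        · rw [Equiv.swap_apply_of_ne_of_ne h1 h2]
    simp only [this]
    exact CharTwo.add_self_eq_zero _
  · intro π _ _ hc
    have : Equiv.swap j.castSucc j.succ = 1 := by simpa using hc
    rw [Equiv.Perm.one_def, Equiv.swap_eq_refl_iff] at this
    exact absurd (congrArg Fin.val this) (by simp)
  · intro π _
    rw [← mul_assoc, Equiv.swap_mul_self, one_mul]

/-- The facet opposite the lowest vertex is shared with a simplex of the adjacent cell, where it is
opposite the highest vertex. -/
theorem vtx_castSucc {m : ℕ} (b : Fin (m + 1) → ℕ) (π : Equiv.Perm (Fin (m + 1)))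
    (i : Fin (m + 1)) :
    vtx b π i.castSucc =
      vtx (b + Pi.single (π.symm (Fin.last m)) 1) (finRotate (m + 1) * π) i.succ := by
  funext c
  unfold vtx
  rw [Equiv.Perm.mul_apply]
  rcases eq_or_ne (π c) (Fin.last m) with h | h
  · have hc : c = π.symm (Fin.last m) := by rw [← h]; simp
    rw [h, finRotate_last, hc]
    simp [Nat.le_of_lt_succ i.2]
  · have hc : c ≠ π.symm (Fin.last m) := fun hc => h (by rw [hc]; simp)
    have h3 : ((finRotate (m + 1) (π c) : Fin (m + 1)) : ℕ) = π c + 1 :=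
      coe_finRotate_of_ne_last h
    rw [h3]
    simp [hc]

/-- Interior facets cancel modulo `2`. On the boundary some required label is missing, except on the
face where coordinate `0` vanishes; there the sum is the one for the cube of one dimension less. -/
theorem sum_labelDet {m N : ℕ} (hN : 0 < N) {lab : (Fin m → ℕ) → ℕ} (h : IsLabelling N lab) :
    ∑ π : Equiv.Perm (Fin m), ∑ b ∈ box m N, labelDet (fun j => lab (vtx b π j)) = 1 := by
  induction m with
  | zero =>
    have h0 : ∀ v, lab v = 0 := fun v => Nat.le_zero.1 (h.le v fun c => c.elim0)
    simp [h0, labelDet, box]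
  | succ m ih =>
    rw [← ih h.cons]
    have e1 : ∀ π : Equiv.Perm (Fin (m + 1)), ∀ b ∈ box (m + 1) N,
        labelDet (fun j => lab (vtx b π j)) =
          labelDet (fun i : Fin (m + 1) => lab (vtx b π i.succ)) +
          (∑ j : Fin m, labelDet (fun i => lab (vtx b π ((j.succ.castSucc).succAbove i)))) +
          labelDet (fun i : Fin (m + 1) => lab (vtx b π i.castSucc)) := by
      intro π b hb
      rw [labelDet_succ (fun i => h.le _ (vtx_le hb π i)), Fin.sum_univ_castSucc,
        Fin.sum_univ_succ]
      simp
    rw [Finset.sum_congr rfl fun π _ => Finset.sum_congr rfl (e1 π)]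
    simp only [Finset.sum_add_distrib]
    have e2 : ∑ π : Equiv.Perm (Fin (m + 1)), ∑ b ∈ box (m + 1) N,
        ∑ j : Fin m, labelDet (fun i => lab (vtx b π ((j.succ.castSucc).succAbove i))) = 0 := by
      rw [Finset.sum_comm]
      refine Finset.sum_eq_zero fun b _ => ?_
      rw [Finset.sum_comm]
      exact Finset.sum_eq_zero fun j _ => sum_facet_middle lab b j
    rw [e2, add_zero]
    set F : Equiv.Perm (Fin (m + 1)) → (Fin (m + 1) → ℕ) → ZMod 2 :=
      fun π b => labelDet (fun i : Fin (m + 1) => lab (vtx b π i.succ)) with hF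
    have hbd : ∀ (π : Equiv.Perm (Fin (m + 1))) (b : Fin (m + 1) → ℕ),
        b (π.symm 0) = N → (∀ x, x ≠ π.symm 0 → b x < N) → F π b = 0 := by
      intro π b hbN hlt
      refine labelDet_eq_zero (Nat.zero_le _) fun i => ?_
      have := h.top (vtx b π i.succ) (fun c => ?_) (π.symm 0) (by simp [vtx, hbN])
      · have := (π.symm 0).2
        omega
      · unfold vtx
        by_cases hc : c = π.symm 0
        · subst hc; simp [hbN]
        · have := hlt c hc
          split_ifs <;> omega
    have e3 : ∑ π : Equiv.Perm (Fin (m + 1)), ∑ b ∈ box (m + 1) N,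
        labelDet (fun i : Fin (m + 1) => lab (vtx b π i.castSucc)) =
        ∑ π : Equiv.Perm (Fin (m + 1)), ∑ b ∈ box (m + 1) N,
          F π (b + Pi.single (π.symm 0) 1) := by
      refine Fintype.sum_equiv (Equiv.mulLeft (finRotate (m + 1))) _ _ fun π => ?_
      refine Finset.sum_congr rfl fun b _ => ?_
      have : (finRotate (m + 1) * π).symm 0 = π.symm (Fin.last m) := by
        rw [Equiv.symm_apply_eq, Equiv.Perm.mul_apply, Equiv.apply_symm_apply, finRotate_last]
      simp only [Equiv.coe_mulLeft, this, hF, vtx_castSucc]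
    rw [e3, ← Finset.sum_add_distrib]
    rw [Finset.sum_congr rfl fun π _ =>
      (add_comm _ _).trans (sum_box_shift (π.symm 0) (F π) (hbd π))]
    have hinv : ∀ π : Equiv.Perm (Fin (m + 1)), π 0 = 0 →
        Equiv.Perm.decomposeFin.symm (0, (Equiv.Perm.decomposeFin π).2) = π := by
      intro π hπ
      obtain ⟨⟨p, e⟩, rfl⟩ := Equiv.Perm.decomposeFin.symm.surjective π
      have : p = 0 := by simpa using hπ
      simp [this]
    rw [← Finset.sum_filter_of_ne (p := fun π : Equiv.Perm (Fin (m + 1)) => π 0 = 0)]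
    · refine Finset.sum_bij' (fun π _ => (Equiv.Perm.decomposeFin π).2)
        (fun e _ => Equiv.Perm.decomposeFin.symm (0, e)) (fun _ _ => Finset.mem_univ _)
        (fun e _ => by simp) ?_ ?_ ?_
      · intro π hπ
        exact hinv π (Finset.mem_filter.1 hπ).2
      · intro e _
        simp
      · intro π hπ
        have hπ0 := (Finset.mem_filter.1 hπ).2
        obtain ⟨e, rfl⟩ : ∃ e, π = Equiv.Perm.decomposeFin.symm (0, e) := ⟨_, (hinv π hπ0).symm⟩
        have hs : (Equiv.Perm.decomposeFin.symm (0, e)).symm 0 = 0 := by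
          rw [Equiv.symm_apply_eq, hπ0]
        simp only [hs, Equiv.apply_symm_apply]
        refine Finset.sum_bij' (fun b _ => Fin.tail b) (fun b _ => Fin.cons 0 b) ?_ ?_ ?_ ?_ ?_
        · intro b hb
          exact mem_box.2 fun c => mem_box.1 (Finset.mem_filter.1 hb).1 c.succ
        · intro b hb
          refine Finset.mem_filter.2 ⟨mem_box.2 fun c => ?_, by simp⟩
          refine Fin.cases (by simpa using hN) (fun c => ?_) c
          simpa using mem_box.1 hb c
        · intro b hb
          have := (Finset.mem_filter.1 hb).2
          rw [← this, Fin.cons_self_tail]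
        · intro b _
          simp
        · intro b hb
          have hb0 := (Finset.mem_filter.1 hb).2
          simp only [hF]
          congr 1
          funext i
          congr 1
          funext c
          refine Fin.cases ?_ (fun c => ?_) c
          · simp [vtx, hb0]
          · simp [vtx, Fin.tail]
    · intro π _ hne
      by_contra hπ
      refine hne (Finset.sum_eq_zero fun b hb => ?_)
      have hb' := Finset.mem_filter.1 hb
      have hc : (π.symm 0 : Fin (m + 1)) ≠ 0 := fun hc =>
        hπ ((Equiv.symm_apply_eq π).1 hc).symm
      refine labelDet_eq_zero (l := m + 1 - ((π.symm 0 : Fin (m + 1)) : ℕ)) ?_ fun i => ?_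
      · have := Fin.val_ne_zero_iff.2 hc
        omega
      · exact h.zero _ (vtx_le hb'.1 π _) _ (by simp [vtx, hb'.2])

/-- Kuhn's cubical Sperner lemma: some cell of the grid carries all labels. -/
theorem exists_full {m N : ℕ} (hN : 0 < N) {lab : (Fin m → ℕ) → ℕ} (h : IsLabelling N lab) :
    ∃ b : Fin m → ℕ, ∀ l ≤ m, ∃ v : Fin m → ℕ,
      (∀ c, v c ≤ N ∧ b c ≤ v c ∧ v c ≤ b c + 1) ∧ lab v = l := by
  have h1 := sum_labelDet hN h
  obtain ⟨π, _, hπ⟩ := Finset.exists_ne_zero_of_sum_ne_zero (h1.trans_ne one_ne_zero)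
  obtain ⟨b, hb, hbπ⟩ := Finset.exists_ne_zero_of_sum_ne_zero hπ
  refine ⟨b, fun l hl => ?_⟩
  by_contra! hcon
  refine hbπ (labelDet_eq_zero hl fun j => hcon _ fun c => ⟨vtx_le hb π j c, ?_⟩)
  unfold vtx
  split_ifs <;> omega

end Kuhn

/-! ### Geometry of CAT(0) spaces -/

theorem IsGeodesicSegment.reverse {X : Type*} [MetricSpace X] {γ : ℝ → X} {x y : X}
    (h : IsGeodesicSegment γ x y) : IsGeodesicSegment (fun t => γ (1 - t)) y x := by
  refine ⟨by simp [h.target], by simp [h.source], fun s hs t ht => ?_⟩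
  rw [h.dist_eq _ ⟨by linarith [hs.2], by linarith [hs.1]⟩ _
    ⟨by linarith [ht.2], by linarith [ht.1]⟩, dist_comm y x, abs_sub_comm]
  congr 2
  ring

theorem exists_comparison_triangle {X : Type*} [MetricSpace X] (p : Fin 3 → X) :
    ∃ q : Fin 3 → EuclideanSpace ℝ (Fin 2),
      ∀ i, dist (q i) (q (i + 1)) = dist (p i) (p (i + 1)) := by
  set a := dist (p 0) (p 1) with ha
  set b := dist (p 1) (p 2) with hb
  set c := dist (p 2) (p 0) with hc
  have ha0 : 0 ≤ a := dist_nonneg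
  have hb0 : 0 ≤ b := dist_nonneg
  have hc0 : 0 ≤ c := dist_nonneg
  have h1 : a ≤ b + c := by
    rw [ha, hb, hc, dist_comm (p 0) (p 1), dist_comm (p 2) (p 0), dist_comm (p 1) (p 0),
      add_comm]
    exact (dist_triangle _ _ _).trans_eq (by rw [dist_comm (p 2)])
  have h2 : b ≤ a + c := by
    rw [ha, hb, hc, dist_comm (p 0) (p 1), dist_comm (p 2) (p 0)]
    exact dist_triangle _ _ _
  have h3 : c ≤ a + b := by
    rw [ha, hb, hc, dist_comm (p 2) (p 0)]
    exact dist_triangle _ _ _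
  -- The law of cosines. If `a = 0`, then `b = c` and division by zero gives the admissible value `x
  -- = 0`.
  set x := (a ^ 2 + c ^ 2 - b ^ 2) / (2 * a) with hx
  have hxa : 2 * a * x = a ^ 2 + c ^ 2 - b ^ 2 := by
    rcases eq_or_ne a 0 with h0 | h0
    · have : b = c := by linarith
      simp [h0, this]
    · rw [hx]; field_simp
  have hxc : x ^ 2 ≤ c ^ 2 := by
    rcases eq_or_ne a 0 with h0 | h0
    · rw [hx, h0, mul_zero, div_zero, zero_pow two_ne_zero]
      exact sq_nonneg c
    · have hapos : 0 < a := lt_of_le_of_ne ha0 (Ne.symm h0)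
      have hm : (2 * a * x) ^ 2 ≤ (2 * a * c) ^ 2 := by
        rw [hxa]
        apply sq_le_sq'
        · nlinarith
        · nlinarith
      have : (2 * a) ^ 2 * x ^ 2 ≤ (2 * a) ^ 2 * c ^ 2 := by nlinarith
      exact le_of_mul_le_mul_left this (by positivity)
  set y := √(c ^ 2 - x ^ 2) with hy
  have hy2 : y ^ 2 = c ^ 2 - x ^ 2 := Real.sq_sqrt (by linarith)
  refine ⟨![!₂[0, 0], !₂[a, 0], !₂[x, y]], fun i => ?_⟩
  fin_cases i
  · simp [EuclideanSpace.dist_eq, Real.dist_eq, Real.sqrt_sq ha0, ← ha]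
  · have : (a - x) ^ 2 + y ^ 2 = b ^ 2 := by nlinarith
    simp [EuclideanSpace.dist_eq, Real.dist_eq, this, Real.sqrt_sq hb0, ← hb]
  · have : x ^ 2 + y ^ 2 = c ^ 2 := by linarith
    simp [EuclideanSpace.dist_eq, Real.dist_eq, this, Real.sqrt_sq hc0, ← hc]

/-- Geodesic convexity of a set. -/
def GeodesicConvex {X : Type*} [MetricSpace X] (C : Set X) : Prop :=
  ∀ x ∈ C, ∀ y ∈ C, ∀ γ : ℝ → X, IsGeodesicSegment γ x y → ∀ t ∈ Set.Icc (0 : ℝ) 1, γ t ∈ C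

namespace IsCAT0

variable {X : Type*} [MetricSpace X]

/-- Stewart's identity in the comparison triangle. All the uniform convexity used below comes from
this inequality. -/
theorem dist_sq_le (hX : IsCAT0 X) {x y : X} {γ : ℝ → X} (hγ : IsGeodesicSegment γ x y) (p : X)
    {t : ℝ} (ht : t ∈ Set.Icc (0 : ℝ) 1) :
    dist p (γ t) ^ 2 ≤
      (1 - t) * dist p x ^ 2 + t * dist p y ^ 2 - t * (1 - t) * dist x y ^ 2 := by
  obtain ⟨γ₁, h1⟩ := hX.exists_geodesic y p
  obtain ⟨γ₂, h2⟩ := hX.exists_geodesic p x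
  obtain ⟨q, hq⟩ := exists_comparison_triangle ![x, y, p]
  have h := hX.comparison ![x, y, p] ![γ, γ₁, γ₂] q
    (by intro i; fin_cases i <;> assumption) hq 0 2 t ht 0 ⟨le_rfl, zero_le_one⟩
  have q0 := hq 0
  have q1 := hq 1
  have q2 := hq 2
  simp only [Matrix.cons_val, Fin.isValue, h2.source, AffineMap.lineMap_apply_zero,
    show (0 : Fin 3) + 1 = 1 from rfl, show (1 : Fin 3) + 1 = 2 from rfl,
    show (2 : Fin 3) + 1 = 0 from rfl] at h q0 q1 q2
  rw [← q0, dist_comm p y, ← q1, ← q2]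
  rw [dist_comm] at h
  refine (pow_le_pow_left₀ dist_nonneg h 2).trans_eq ?_
  set u := q 0 - q 2 with hu
  set v := q 1 - q 2 with hv
  have e1 : AffineMap.lineMap (q 0) (q 1) t - q 2 = (1 - t) • u + t • v := by
    rw [AffineMap.lineMap_apply_module, hu, hv]
    module
  have e2 : q 0 - q 1 = u - v := by rw [hu, hv]; abel
  rw [dist_comm (q 2) (q 0), dist_eq_norm, dist_eq_norm, dist_eq_norm, dist_eq_norm, e1, e2,
    ← hu, ← hv, norm_add_sq_real, norm_sub_sq_real u v, norm_smul, norm_smul, mul_pow, mul_pow,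
    inner_smul_left, inner_smul_right]
  simp only [Real.norm_eq_abs, sq_abs, conj_trivial]
  ring

theorem geodesic_unique (hX : IsCAT0 X) {x y : X} {γ γ' : ℝ → X} (h : IsGeodesicSegment γ x y)
    (h' : IsGeodesicSegment γ' x y) {t : ℝ} (ht : t ∈ Set.Icc (0 : ℝ) 1) : γ t = γ' t := by
  -- With `γ t` as the third vertex, the right-hand side evaluates to zero.
  have h1 := hX.dist_sq_le h' (γ t) ht
  have h2 := h.dist_eq t ht 0 ⟨le_rfl, zero_le_one⟩
  have h3 := h.dist_eq t ht 1 ⟨zero_le_one, le_rfl⟩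
  rw [h.source, sub_zero, abs_of_nonneg ht.1] at h2
  rw [h.target, abs_of_nonpos (by linarith [ht.2])] at h3
  rw [h2, h3] at h1
  have h4 : dist (γ t) (γ' t) ^ 2 ≤ 0 := h1.trans_eq (by ring)
  exact dist_eq_zero.1 (pow_eq_zero_iff two_ne_zero |>.1 (le_antisymm h4 (sq_nonneg _)))

theorem dist_geodesic_le (hX : IsCAT0 X) {x y p : X} {γ γ' : ℝ → X}
    (h : IsGeodesicSegment γ x p) (h' : IsGeodesicSegment γ' y p) {t : ℝ}
    (ht : t ∈ Set.Icc (0 : ℝ) 1) : dist (γ t) (γ' t) ≤ (1 - t) * dist x y := by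
  obtain ⟨γ₁, h1⟩ := hX.exists_geodesic x y
  obtain ⟨q, hq⟩ := exists_comparison_triangle ![p, x, y]
  have ht' : 1 - t ∈ Set.Icc (0 : ℝ) 1 := ⟨by linarith [ht.2], by linarith [ht.1]⟩
  have h := hX.comparison ![p, x, y] ![fun t => γ (1 - t), γ₁, γ'] q
    (by intro i; fin_cases i; exacts [h.reverse, h1, h']) hq 0 2 (1 - t) ht' t ht
  have q1 := hq 1
  simp only [Matrix.cons_val, Fin.isValue, sub_sub_cancel,
    show (0 : Fin 3) + 1 = 1 from rfl, show (1 : Fin 3) + 1 = 2 from rfl,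
    show (2 : Fin 3) + 1 = 0 from rfl] at h q1
  refine h.trans_eq ?_
  rw [← q1, dist_eq_norm, dist_eq_norm, AffineMap.lineMap_apply_module,
    AffineMap.lineMap_apply_module,
    show (1 - (1 - t)) • q 0 + (1 - t) • q 1 - ((1 - t) • q 2 + t • q 0) =
      (1 - t) • (q 1 - q 2) by module, norm_smul, Real.norm_of_nonneg ht'.1]

/-- The geodesic from `x` to `y`, extended to `ℝ` by constants. -/
noncomputable def geo (hX : IsCAT0 X) (x y : X) (t : ℝ) : X :=
  (hX.exists_geodesic x y).choose (Set.projIcc 0 1 zero_le_one t)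

theorem isGeodesicSegment_geo (hX : IsCAT0 X) (x y : X) :
    IsGeodesicSegment (hX.geo x y) x y := by
  have h := (hX.exists_geodesic x y).choose_spec
  refine ⟨?_, ?_, fun s hs t ht => ?_⟩
  · simpa [geo] using h.source
  · simpa [geo] using h.target
  · simp only [geo, Set.projIcc_of_mem _ hs, Set.projIcc_of_mem _ ht]
    exact h.dist_eq s hs t ht

theorem geo_projIcc (hX : IsCAT0 X) (x y : X) (t : ℝ) :
    hX.geo x y (Set.projIcc 0 1 zero_le_one t) = hX.geo x y t := by
  simp [geo]

theorem dist_geo_le (hX : IsCAT0 X) (x x' y : X) (s t : ℝ) :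
    dist (hX.geo x y s) (hX.geo x' y t) ≤ |s - t| * dist x y + dist x x' := by
  rw [← hX.geo_projIcc x y s, ← hX.geo_projIcc x' y t]
  refine (dist_triangle _ (hX.geo x y (Set.projIcc 0 1 zero_le_one t)) _).trans (add_le_add ?_ ?_)
  · rw [(hX.isGeodesicSegment_geo x y).dist_eq _ (Subtype.prop _) _ (Subtype.prop _)]
    exact mul_le_mul_of_nonneg_right (Set.abs_projIcc_sub_projIcc zero_le_one) dist_nonneg
  · set r := Set.projIcc (0 : ℝ) 1 zero_le_one t
    refine (hX.dist_geodesic_le (hX.isGeodesicSegment_geo x y)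
      (hX.isGeodesicSegment_geo x' y) r.2).trans ?_
    exact mul_le_of_le_one_left dist_nonneg (by linarith [r.2.1])

theorem continuous_geo (hX : IsCAT0 X) (y : X) :
    Continuous fun z : X × ℝ => hX.geo z.1 y z.2 := by
  rw [continuous_iff_continuousAt]
  rintro ⟨x, s⟩
  rw [ContinuousAt, tendsto_iff_dist_tendsto_zero]
  have h0 : Filter.Tendsto (fun z : X × ℝ => |s - z.2| * dist x y + dist x z.1)
      (nhds (x, s)) (nhds 0) := by
    have : Continuous fun z : X × ℝ => |s - z.2| * dist x y + dist x z.1 := by fun_prop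
    simpa using this.tendsto (x, s)
  refine squeeze_zero (fun _ => dist_nonneg) (fun z => ?_) h0
  rw [dist_comm]
  exact hX.dist_geo_le _ _ _ _ _

theorem geo_mem (hX : IsCAT0 X) {C : Set X} (hC : GeodesicConvex C) {x y : X} (hx : x ∈ C)
    (hy : y ∈ C) (t : ℝ) : hX.geo x y t ∈ C := by
  rw [← hX.geo_projIcc]
  exact hC x hx y hy _ (hX.isGeodesicSegment_geo x y) _ (Subtype.prop _)

/-- A uniformly convex function has a unique minimum on a closed convex set. -/
theorem exists_unique_min (hX : IsCAT0 X) [CompleteSpace X] {C : Set X} (hCc : IsClosed C)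
    (hC : GeodesicConvex C) (hne : C.Nonempty) (F : X → ℝ) (hF : Continuous F)
    (hF0 : ∀ x, 0 ≤ F x)
    (hmid : ∀ x y (γ : ℝ → X), IsGeodesicSegment γ x y →
      F (γ (1 / 2)) ≤ (F x + F y) / 2 - dist x y ^ 2 / 4) :
    ∃ m ∈ C, ∀ x ∈ C, F x ≤ F m → x = m := by
  set I := sInf (F '' C) with hI
  have hbdd : BddBelow (F '' C) := ⟨0, by rintro _ ⟨x, _, rfl⟩; exact hF0 x⟩
  have hIle : ∀ x ∈ C, I ≤ F x := fun x hx => csInf_le hbdd ⟨x, hx, rfl⟩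
  -- The midpoint value is at least the infimum, so near-minimisers are close together; this makes
  -- minimising sequences Cauchy and the minimum unique.
  have hd : ∀ x ∈ C, ∀ y ∈ C, dist x y ^ 2 ≤ 2 * ((F x - I) + (F y - I)) := by
    intro x hx y hy
    obtain ⟨γ, hγ⟩ := hX.exists_geodesic x y
    have h1 := hmid x y γ hγ
    have h2 := hIle _ (hC x hx y hy γ hγ (1 / 2) ⟨by norm_num, by norm_num⟩)
    linarith
  have hu : ∀ n : ℕ, ∃ x ∈ C, F x < I + 1 / ((n : ℝ) + 1) := by
    intro n
    obtain ⟨_, ⟨x, hx, rfl⟩, h⟩ := exists_lt_of_csInf_lt (hne.image F)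
      (show I < I + 1 / ((n : ℝ) + 1) by
        have : 0 < 1 / ((n : ℝ) + 1) := by positivity
        linarith)
    exact ⟨x, hx, h⟩
  choose u huC hu using hu
  have hlim : Filter.Tendsto (fun n : ℕ => 1 / ((n : ℝ) + 1)) Filter.atTop (nhds 0) :=
    tendsto_one_div_add_atTop_nhds_zero_nat
  have hcau : CauchySeq u := by
    refine cauchySeq_of_le_tendsto_0 (fun n : ℕ => √(4 * (1 / ((n : ℝ) + 1)))) ?_ ?_
    · intro n m N hn hm
      apply Real.le_sqrt_of_sq_le
      refine (hd _ (huC n) _ (huC m)).trans ?_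
      have h1 := hu n
      have h2 := hu m
      have h3 : 1 / ((n : ℝ) + 1) ≤ 1 / ((N : ℝ) + 1) := Nat.one_div_le_one_div hn
      have h4 : 1 / ((m : ℝ) + 1) ≤ 1 / ((N : ℝ) + 1) := Nat.one_div_le_one_div hm
      linarith
    · simpa using (hlim.const_mul 4).sqrt
  obtain ⟨m, hm⟩ := cauchySeq_tendsto_of_complete hcau
  have hmC : m ∈ C := hCc.mem_of_tendsto hm (Filter.Eventually.of_forall huC)
  have hFm : F m ≤ I := by
    have h1 : Filter.Tendsto (fun n => F (u n)) Filter.atTop (nhds (F m)) :=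
      (hF.tendsto m).comp hm
    have h2 := hlim.const_add I
    rw [add_zero] at h2
    exact le_of_tendsto_of_tendsto' h1 h2 fun n => (hu n).le
  refine ⟨m, hmC, fun x hx hxm => ?_⟩
  have h := hd x hx m hmC
  have : dist x m ^ 2 ≤ 0 := by linarith
  exact dist_eq_zero.1 (pow_eq_zero_iff two_ne_zero |>.1 (le_antisymm this (sq_nonneg _)))

theorem sum_dist_sq_mid (hX : IsCAT0 X) {ι : Type*} {s : Finset ι} (hs : s.Nonempty) (q : ι → X)
    {x y : X} {γ : ℝ → X} (hγ : IsGeodesicSegment γ x y) :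
    ∑ i ∈ s, dist (q i) (γ (1 / 2)) ^ 2 ≤
      (∑ i ∈ s, dist (q i) x ^ 2 + ∑ i ∈ s, dist (q i) y ^ 2) / 2 - dist x y ^ 2 / 4 := by
  have h1 : ∀ i ∈ s, dist (q i) (γ (1 / 2)) ^ 2 ≤
      (dist (q i) x ^ 2 + dist (q i) y ^ 2) / 2 - dist x y ^ 2 / 4 := by
    intro i _
    have := hX.dist_sq_le hγ (q i) (t := 1 / 2) ⟨by norm_num, by norm_num⟩
    linarith
  refine (Finset.sum_le_sum h1).trans ?_
  rw [Finset.sum_sub_distrib, ← Finset.sum_div, Finset.sum_add_distrib, Finset.sum_const,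
    nsmul_eq_mul]
  have h2 : (1 : ℝ) ≤ s.card := by exact_mod_cast hs.card_pos
  have h3 : (0 : ℝ) ≤ dist x y ^ 2 / 4 := by positivity
  nlinarith

/-- One point gives the nearest-point projection to `C`; a finite orbit gives its barycentre. -/
theorem exists_unique_min_sum (hX : IsCAT0 X) [CompleteSpace X] {ι : Type*} {s : Finset ι}
    (hs : s.Nonempty) (q : ι → X) {C : Set X} (hCc : IsClosed C)
    (hC : GeodesicConvex C) (hne : C.Nonempty) :
    ∃ m ∈ C, ∀ x ∈ C, ∑ i ∈ s, dist (q i) x ^ 2 ≤ ∑ i ∈ s, dist (q i) m ^ 2 → x = m :=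
  hX.exists_unique_min hCc hC hne (fun x => ∑ i ∈ s, dist (q i) x ^ 2) (by fun_prop)
    (fun x => by positivity) fun _ _ _ hγ => hX.sum_dist_sq_mid hs q hγ

end IsCAT0

/-! ### Isometries with fixed points -/

/-- The element `g` has a fixed point in `X`. -/
def HasFixedPoint (X : Type*) {G : Type*} [Group G] [MulAction G X] (g : G) : Prop :=
  ∃ x : X, g • x = x

theorem HasFixedPoint.inv {X G : Type*} [Group G] [MulAction G X] {g : G} (h : HasFixedPoint X g) : HasFixedPoint X g⁻¹ := by
  obtain ⟨x, hx⟩ := h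
  exact ⟨x, by rw [inv_smul_eq_iff, hx]⟩

theorem HasFixedPoint.conj {X G : Type*} [Group G] [MulAction G X] {g : G} (h : HasFixedPoint X g) (k : G) :
    HasFixedPoint X (k * g * k⁻¹) := by
  obtain ⟨x, hx⟩ := h
  exact ⟨k • x, by rw [mul_smul, inv_smul_smul, mul_smul, hx]⟩

section Elliptic

variable {X : Type*} [MetricSpace X] {G : Type*} [Group G] [MulAction G X] [IsIsometricSMul G X]

theorem IsGeodesicSegment.smul (g : G) {γ : ℝ → X} {x y : X} (h : IsGeodesicSegment γ x y) :
    IsGeodesicSegment (fun t => g • γ t) (g • x) (g • y) :=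
  ⟨by rw [h.source], by rw [h.target], fun s hs t ht => by
    rw [dist_smul, dist_smul, h.dist_eq s hs t ht]⟩

theorem IsCAT0.geodesicConvex_fixedBy (hX : IsCAT0 X) (g : G) :
    GeodesicConvex (MulAction.fixedBy X g) := by
  intro x hx y hy γ hγ t ht
  have h := hγ.smul g
  rw [MulAction.mem_fixedBy.1 hx, MulAction.mem_fixedBy.1 hy] at h
  exact hX.geodesic_unique h hγ ht

theorem isClosed_fixedBy_of_isometric (g : G) : IsClosed (MulAction.fixedBy X g) :=
  isClosed_eq (isometry_smul X g).continuous continuous_id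

theorem geodesicConvex_univ : GeodesicConvex (Set.univ : Set X) :=
  fun _ _ _ _ _ _ _ _ => Set.mem_univ _

/-- Project a fixed point of `g` to the fixed set of `h`. Since `g` preserves this set, uniqueness
of the projection shows that `g` fixes it. -/
theorem IsCAT0.hasFixedPoint_mul (hX : IsCAT0 X) [CompleteSpace X] {g h : G}
    (hgh : Commute g h) (hg : HasFixedPoint X g) (hh : HasFixedPoint X h) :
    HasFixedPoint X (g * h) := by
  obtain ⟨p, hp⟩ := hg
  obtain ⟨m, hm, hmin⟩ := hX.exists_unique_min_sum (Finset.singleton_nonempty ()) (fun _ => p)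
    (isClosed_fixedBy_of_isometric h) (hX.geodesicConvex_fixedBy h) hh
  have hm' : h • m = m := hm
  refine ⟨m, ?_⟩
  rw [mul_smul, hm']
  refine hmin _ ?_ ?_
  · rw [MulAction.mem_fixedBy, smul_smul, ← hgh.eq, mul_smul, hm']
  · nth_rewrite 1 [← hp]
    simp

/-- The orbit of `p` under `g` is finite, so its barycentre is fixed. -/
theorem IsCAT0.hasFixedPoint_of_pow (hX : IsCAT0 X) [CompleteSpace X] {g : G} {k : ℕ}
    (hk : 0 < k) (h : HasFixedPoint X (g ^ k)) : HasFixedPoint X g := by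
  obtain ⟨p, hp⟩ := h
  obtain ⟨m, _, hmin⟩ := hX.exists_unique_min_sum
    (Finset.nonempty_range_iff.2 hk.ne') (fun i => g ^ i • p) isClosed_univ
    geodesicConvex_univ ⟨p, trivial⟩
  refine ⟨m, hmin _ trivial (le_of_eq ?_)⟩
  have h1 := Finset.sum_range_succ (fun i => dist (g ^ i • p) (g • m) ^ 2) k
  rw [Finset.sum_range_succ', hp, pow_zero, one_smul] at h1
  rw [← add_right_cancel h1]
  refine Finset.sum_congr rfl fun i _ => ?_
  rw [pow_succ' g, mul_smul, dist_smul]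

/-- A finite group of isometries has a fixed point. -/
theorem IsCAT0.exists_fixed_of_finite (hX : IsCAT0 X) [CompleteSpace X] [Nonempty X]
    {H : Type*} [Group H] [Fintype H] (P : H →* G) : ∃ x : X, ∀ h, P h • x = x := by
  obtain ⟨p⟩ := ‹Nonempty X›
  obtain ⟨m, _, hmin⟩ := hX.exists_unique_min_sum
    (Finset.univ_nonempty (α := H)) (fun i => P i • p) isClosed_univ
    geodesicConvex_univ ⟨p, trivial⟩
  refine ⟨m, fun h => hmin _ trivial (le_of_eq ?_)⟩
  refine Fintype.sum_equiv (Equiv.mulLeft h⁻¹) _ _ fun i => ?_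
  simp only [Equiv.coe_mulLeft, map_mul, map_inv, mul_smul]
  rw [← dist_smul (P h) ((P h)⁻¹ • P i • p), smul_inv_smul]

end Elliptic

/-! ### Helly's theorem -/

namespace IsCAT0

variable {X : Type*} [MetricSpace X]

/-- Iterated geodesic coning: a singular simplex with vertices `p 0, …, p k`, parametrised by the
cube. -/
noncomputable def coneMap (hX : IsCAT0 X) (p : ℕ → X) : (k : ℕ) → (Fin k → ℝ) → X
  | 0, _ => p 0
  | k + 1, t => hX.geo (coneMap hX p k (Fin.tail t)) (p (k + 1)) (t 0)

theorem continuous_coneMap (hX : IsCAT0 X) (p : ℕ → X) (k : ℕ) :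
    Continuous (hX.coneMap p k) := by
  induction k with
  | zero => exact continuous_const
  | succ k ih =>
    have h1 : Continuous fun t : Fin (k + 1) → ℝ => (hX.coneMap p k (Fin.tail t), t 0) :=
      (ih.comp (continuous_pi fun i => continuous_apply i.succ)).prodMk (continuous_apply 0)
    exact (hX.continuous_geo (p (k + 1))).comp h1

theorem coneMap_mem (hX : IsCAT0 X) {p : ℕ → X} {C : Set X} (hC : GeodesicConvex C) {k : ℕ}
    (hp : ∀ l ≤ k, p l ∈ C) (t : Fin k → ℝ) : hX.coneMap p k t ∈ C := by
  induction k with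
  | zero => exact hp 0 le_rfl
  | succ k ih => exact hX.geo_mem hC (ih (fun l hl => hp l (by omega)) _) (hp _ le_rfl) _

/-- Coordinate `c` governs coning to `p (k - c)`; at `0` that vertex is not used. -/
theorem coneMap_mem_of_eq_zero (hX : IsCAT0 X) {p : ℕ → X} {C : Set X} (hC : GeodesicConvex C)
    {k : ℕ} (c : Fin k) (hp : ∀ l ≤ k, l ≠ k - c → p l ∈ C) {t : Fin k → ℝ} (ht : t c = 0) :
    hX.coneMap p k t ∈ C := by
  induction k with
  | zero => exact c.elim0
  | succ k ih =>
    rcases Fin.eq_zero_or_eq_succ c with rfl | ⟨c, rfl⟩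
    · rw [coneMap, ht, (hX.isGeodesicSegment_geo _ _).source]
      exact hX.coneMap_mem hC (fun l hl => hp l (by omega) (by simp; omega)) _
    · refine hX.geo_mem hC (ih c (fun l hl hlc => hp l (by omega) ?_) ht)
        (hp _ le_rfl ?_) _
      · simpa using hlc
      · simp only [Fin.val_succ]
        omega

/-- At `1` the cone collapses to its apex `p (k - c)`, so only this vertex and the later ones
matter. -/
theorem coneMap_mem_of_eq_one (hX : IsCAT0 X) {p : ℕ → X} {C : Set X} (hC : GeodesicConvex C)
    {k : ℕ} (c : Fin k) (hp : ∀ l ≤ k, k - c ≤ l → p l ∈ C) {t : Fin k → ℝ} (ht : t c = 1) :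
    hX.coneMap p k t ∈ C := by
  induction k with
  | zero => exact c.elim0
  | succ k ih =>
    rcases Fin.eq_zero_or_eq_succ c with rfl | ⟨c, rfl⟩
    · rw [coneMap, ht, (hX.isGeodesicSegment_geo _ _).target]
      exact hp _ le_rfl (Nat.sub_le _ _)
    · refine hX.geo_mem hC (ih c (fun l hl hlc => hp l (by omega) ?_) ht)
        (hp _ le_rfl (Nat.sub_le _ _)) _
      simpa using hlc

theorem helly (hX : IsCAT0 X) {k : ℕ} (hdim : HasCoveringDimensionLT X k) (C : ℕ → Set X)
    (hCc : ∀ i, IsClosed (C i)) (hC : ∀ i, GeodesicConvex (C i)) (p : ℕ → X)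
    (hp : ∀ i ≤ k, ∀ j ≤ k, j ≠ i → p j ∈ C i) : ∃ x, ∀ i ≤ k, x ∈ C i := by
  classical
  by_contra! hcon
  obtain ⟨𝒱, -, hVo, hVc, hVr, hVk⟩ := hdim ((fun i => (C i)ᶜ) '' Set.Iic k)
    ((Set.finite_Iic k).image _) (by rintro _ ⟨i, _, rfl⟩; exact (hCc i).isOpen_compl)
    (by
      refine Set.eq_univ_of_forall fun x => ?_
      obtain ⟨i, hi, hx⟩ := hcon x
      exact ⟨_, ⟨i, hi, rfl⟩, hx⟩)
  have hr : ∀ V : Set X, ∃ i, V ∈ 𝒱 → i ≤ k ∧ V ⊆ (C i)ᶜ := by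
    intro V
    by_cases hV : V ∈ 𝒱
    · obtain ⟨_, ⟨i, hi, rfl⟩, h⟩ := hVr V hV
      exact ⟨i, fun _ => ⟨hi, h⟩⟩
    · exact ⟨0, fun h => absurd h hV⟩
  choose φ hφ using hr
  -- Amalgamating the refinement by index gives one open set inside each complement; a point in all
  -- `W i`, `i ≤ k`, lies in `k + 1` distinct members of `𝒱`.
  set W : ℕ → Set X := fun i => ⋃₀ {V ∈ 𝒱 | φ V = i} with hW
  have hWo : ∀ i, IsOpen (W i) := fun i => isOpen_sUnion fun V hV => hVo V hV.1
  have hWk : ∀ i x, x ∈ W i → i ≤ k ∧ x ∉ C i := by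
    rintro i x ⟨V, ⟨hV, rfl⟩, hx⟩
    exact ⟨(hφ V hV).1, (hφ V hV).2 hx⟩
  have hWc : ∀ x, ∃ i, x ∈ W i := by
    intro x
    obtain ⟨V, hV, hx⟩ : x ∈ ⋃₀ 𝒱 := hVc ▸ Set.mem_univ x
    exact ⟨φ V, V, ⟨hV, rfl⟩, hx⟩
  set f := hX.coneMap p k with hf
  obtain ⟨δ, hδ, hball⟩ := lebesgue_number_lemma_of_metric
    (isCompact_Icc : IsCompact (Set.Icc (0 : Fin k → ℝ) 1)) (c := fun i => f ⁻¹' W i)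
    (fun i => (hWo i).preimage (hX.continuous_coneMap p k))
    (fun t _ => Set.mem_iUnion.2 (hWc (f t)))
  obtain ⟨M, hM⟩ := exists_nat_one_div_lt hδ
  set N := M + 1 with hN
  have hNpos : (0 : ℝ) < N := by positivity
  set pt : (Fin k → ℕ) → Fin k → ℝ := fun v c => v c / N with hpt
  have hptmem : ∀ v : Fin k → ℕ, (∀ c, v c ≤ N) → pt v ∈ Set.Icc (0 : Fin k → ℝ) 1 := by
    refine fun v hv => ⟨fun c => by simp only [hpt, Pi.zero_apply]; positivity, fun c => ?_⟩
    simp only [hpt, Pi.one_apply]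
    rw [div_le_one hNpos]
    exact_mod_cast hv c
  have hlab : ∀ v : Fin k → ℕ, ∃ i, (∀ c, v c ≤ N) → Metric.ball (pt v) δ ⊆ f ⁻¹' W i := by
    intro v
    by_cases hv : ∀ c, v c ≤ N
    · obtain ⟨i, hi⟩ := hball _ (hptmem v hv)
      exact ⟨i, fun _ => hi⟩
    · exact ⟨0, fun h => absurd h hv⟩
  choose lab hlab using hlab
  have hmem : ∀ v, (∀ c, v c ≤ N) → f (pt v) ∈ W (lab v) := fun v hv =>
    hlab v hv (Metric.mem_ball_self hδ)
  have hL : Kuhn.IsLabelling N lab := by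
    refine ⟨fun v hv => (hWk _ _ (hmem v hv)).1, fun v hv c hc hvc => ?_, fun v hv c hc => ?_⟩
    · refine (hWk _ _ (hmem v hv)).2 (hX.coneMap_mem_of_eq_zero (hC _) c (fun l hl hlc => ?_) ?_)
      · exact hp _ (hWk _ _ (hmem v hv)).1 _ hl (by rw [hvc]; exact hlc)
      · simp [hpt, hc]
    · by_contra! hlt
      refine (hWk _ _ (hmem v hv)).2 (hX.coneMap_mem_of_eq_one (hC _) c (fun l hl hlc => ?_) ?_)
      · exact hp _ (hWk _ _ (hmem v hv)).1 _ hl (by omega)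
      · simp only [hpt, hc]
        exact div_self hNpos.ne'
  obtain ⟨b, hb⟩ := Kuhn.exists_full (Nat.succ_pos M) hL
  choose! v hv hvl using hb
  -- Vertices of one cell are within `1 / N < δ` in the sup metric, so one of them lies in the
  -- Lebesgue ball of each.
  have hx : ∀ l ≤ k, f (pt (v 0)) ∈ W l := by
    intro l hl
    have h1 := hlab (v l) (fun c => (hv l hl c).1)
    rw [hvl l hl] at h1
    refine h1 ?_
    rw [Metric.mem_ball, dist_pi_lt_iff hδ]
    intro c
    have h2 := (hv l hl c).2
    have h3 := (hv 0 (Nat.zero_le _) c).2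
    rw [Real.dist_eq]
    simp only [hpt]
    rw [← sub_div, abs_div, abs_of_pos hNpos]
    refine lt_of_le_of_lt ?_ hM
    rw [hN]
    push_cast
    gcongr
    rw [abs_le]
    have h4 : (v 0 c : ℝ) ≤ v l c + 1 := by exact_mod_cast (by omega : v 0 c ≤ v l c + 1)
    have h5 : (v l c : ℝ) ≤ v 0 c + 1 := by exact_mod_cast (by omega : v l c ≤ v 0 c + 1)
    constructor <;> linarith
  have hsub : Set.Iic k ⊆ φ '' {V ∈ 𝒱 | f (pt (v 0)) ∈ V} := by
    intro l hl
    obtain ⟨V, ⟨hV, hVl⟩, hxV⟩ := hx l hl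
    exact ⟨V, ⟨hV, hxV⟩, hVl⟩
  have hcard := (Set.encard_le_encard hsub).trans
    ((Set.encard_image_le φ _).trans (hVk (f (pt (v 0)))))
  rw [← Finset.coe_Iic, Set.encard_coe_eq_coe_finsetCard, Nat.card_Iic] at hcard
  have : k + 1 ≤ k := by exact_mod_cast hcard
  omega

end IsCAT0

/-! ### Actions of affine symmetric groups -/

section AffineSymmetric

open Multiplicative

variable {X : Type*} [MetricSpace X] [CompleteSpace X] [Nonempty X]
  {G : Type*} [Group G] [MulAction G X] [IsIsometricSMul G X]

/-- If `ℤ ^ (k + 1) ⋊ S_(k + 1)` acts on a complete CAT(0) space of dimension less than `k`, then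
the translations in the affine Coxeter group of type `A` have fixed points. -/
theorem IsCAT0.hasFixedPoint_translation (hX : IsCAT0 X) {k : ℕ} (hk : 0 < k)
    (hdim : HasCoveringDimensionLT X k) (P : Equiv.Perm (Fin (k + 1)) →* G)
    (T : Multiplicative (Fin (k + 1) → ℤ) →* G)
    (hPT : ∀ σ v, P σ * T (ofAdd v) = T (ofAdd fun c => v (σ.symm c)) * P σ)
    {i j : Fin (k + 1)} (hij : i ≠ j) :
    HasFixedPoint X (T (ofAdd (Pi.single i 1 - Pi.single j 1))) := by
  obtain ⟨x₀, hx₀⟩ := hX.exists_fixed_of_finite P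
  -- The `w j`, `j ≤ k`, are the vertices of the fundamental alcove and the `s i` the reflections in
  -- its walls: `s i` fixes every `w j` with `j ≠ i`.
  set w : ℕ → Fin (k + 1) → ℤ := fun j c => if (c : ℕ) < j then 1 else 0 with hw
  set e : Fin (k + 1) → ℤ := Pi.single 0 1 - Pi.single (Fin.last k) 1 with he
  set s : ℕ → G := fun i => if h : 0 < i ∧ i ≤ k then
      P (Equiv.swap ⟨i - 1, by omega⟩ ⟨i, by omega⟩)
    else T (ofAdd e) * P (Equiv.swap 0 (Fin.last k)) with hs
  have hP : ∀ σ v, P σ • T (ofAdd v) • x₀ = T (ofAdd fun c => v (σ.symm c)) • x₀ := by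
    intro σ v
    rw [smul_smul, hPT, mul_smul, hx₀]
  have h0last : (0 : Fin (k + 1)) ≠ Fin.last k := fun h => by
    have := congrArg Fin.val h
    simp at this
    omega
  obtain ⟨x, hx⟩ := hX.helly hdim (fun i => MulAction.fixedBy X (s i))
    (fun i => isClosed_fixedBy_of_isometric _) (fun i => hX.geodesicConvex_fixedBy _)
    (fun j => T (ofAdd (w j)) • x₀) (by
      intro i hi j hj hji
      rw [MulAction.mem_fixedBy]
      by_cases h : 0 < i ∧ i ≤ k
      · simp only [hs, h, and_self, dif_pos]
        rw [hP]
        congr 3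
        funext c
        rw [Equiv.symm_swap]
        rcases eq_or_ne c ⟨i - 1, by omega⟩ with rfl | h1
        · rw [Equiv.swap_apply_left]
          have : i < j ↔ i - 1 < j := by omega
          simp only [hw, this]
        · rcases eq_or_ne c ⟨i, by omega⟩ with rfl | h2
          · rw [Equiv.swap_apply_right]
            have : i < j ↔ i - 1 < j := by omega
            simp only [hw, this]
          · rw [Equiv.swap_apply_of_ne_of_ne h1 h2]
      · simp only [hs, h, dif_neg, not_false_eq_true]
        rw [mul_smul, hP, smul_smul, ← map_mul, ← ofAdd_add]
        congr 3
        funext c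
        rw [Equiv.symm_swap]
        have hj0 : 0 < j := by omega
        rcases eq_or_ne c 0 with rfl | h1
        · simp [hw, he, h0last, hj, hj0]
        · rcases eq_or_ne c (Fin.last k) with rfl | h2
          · simp [hw, he, h0last.symm, hj, hj0]
          · simp [Equiv.swap_apply_of_ne_of_ne h1 h2, he, h1, h2])
  -- Adjacent transpositions generate the symmetric group; the affine reflection `s 0` then leaves
  -- only its translation part.
  have hPx : ∀ σ, P σ • x = x := by
    intro σ
    have hσ : σ ∈ Submonoid.closure
        (Set.range fun i : Fin k => Equiv.swap i.castSucc i.succ) := by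
      rw [Equiv.Perm.mclosure_swap_castSucc_succ]
      trivial
    induction hσ using Submonoid.closure_induction with
    | mem σ hσ =>
      obtain ⟨i, rfl⟩ := hσ
      have h := hx (i + 1) i.2
      have hi : 0 < (i : ℕ) + 1 ∧ (i : ℕ) + 1 ≤ k := ⟨by omega, i.2⟩
      simp only [hs, hi, and_self, dif_pos, MulAction.mem_fixedBy] at h
      exact h
    | one => rw [map_one, one_smul]
    | mul a b _ _ ha hb => rw [map_mul, mul_smul, hb, ha]
  have hTe : HasFixedPoint X (T (ofAdd e)) := by
    refine ⟨x, ?_⟩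
    have h := hx 0 (Nat.zero_le _)
    simp only [hs, lt_irrefl, false_and, dif_neg, not_false_eq_true, MulAction.mem_fixedBy,
      mul_smul, hPx] at h
    exact h
  -- A permutation with `0 ↦ i` and `Fin.last k ↦ j`, carrying `e` to the required vector.
  set σ : Equiv.Perm (Fin (k + 1)) :=
    Equiv.swap (Equiv.swap 0 i (Fin.last k)) j * Equiv.swap 0 i with hσ
  have h1 : σ 0 = i := by
    rw [hσ, Equiv.Perm.mul_apply, Equiv.swap_apply_left, Equiv.swap_apply_of_ne_of_ne _ hij]
    intro h
    rw [eq_comm, Equiv.swap_apply_eq_iff, Equiv.swap_apply_right] at h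
    exact h0last h.symm
  have h2 : σ (Fin.last k) = j := by
    rw [hσ, Equiv.Perm.mul_apply, Equiv.swap_apply_left]
  have h3 := hTe.conj (P σ)
  rw [hPT, mul_inv_cancel_right] at h3
  convert h3 using 3
  funext c
  simp only [he, Pi.sub_apply, Pi.single_apply, Equiv.symm_apply_eq, h1, h2]

end AffineSymmetric

/-! ### Automorphisms of free groups -/

namespace FreeGroupAut

open Multiplicative
open FreeGroup (of)

theorem mulAut_ext {ι : Type*} {f g : MulAut (FreeGroup ι)} (h : ∀ k, f (of k) = g (of k)) :
    f = g :=
  MulEquiv.toMonoidHom_injective (FreeGroup.ext_hom f.toMonoidHom g.toMonoidHom h)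

/-- A group acting on a free group, given by the images of the generators. -/
def autHom {H ι : Type*} [Group H] (w : H → ι → FreeGroup ι) (h_one : ∀ k, w 1 k = of k)
    (h_mul : ∀ a b k, FreeGroup.lift (w a) (w b k) = w (a * b) k) :
    H →* MulAut (FreeGroup ι) where
  toFun a := MonoidHom.toMulEquiv (FreeGroup.lift (w a)) (FreeGroup.lift (w a⁻¹))
    (by ext k; simp [h_one, h_mul]) (by ext k; simp [h_one, h_mul])
  map_one' := mulAut_ext fun k => by simp [h_one]
  map_mul' a b := mulAut_ext fun k => by simp [h_mul]

theorem autHom_of {H ι : Type*} [Group H] (w : H → ι → FreeGroup ι) (h_one : ∀ k, w 1 k = of k)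
    (h_mul : ∀ a b k, FreeGroup.lift (w a) (w b k) = w (a * b) k) (a : H) (k : ι) :
    autHom w h_one h_mul a (of k) = w a k := by
  simp [autHom]

/-- The homomorphism through which the translations of the affine symmetric group act. -/
def transHom {ι : Type*} (z : ι) : Multiplicative (ι → ℤ) →* Multiplicative ((ι → ℤ) × (ι → ℤ)) :=
  AddMonoidHom.toMultiplicative
    { toFun := fun v => ((fun _ => -v z), v)
      map_zero' := by ext <;> simp
      map_add' := fun v w => by ext <;> simp [add_comm] }

theorem transHom_ofAdd {ι : Type*} (z : ι) (v : ι → ℤ) : transHom z (ofAdd v) = ofAdd ((fun _ => -v z), v) := rfl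

variable {ι : Type*} [DecidableEq ι] (z : ι)

/-- The generators other than `z`, together with `1` in place of the generator `z`. -/
def pointed (k : ι) : FreeGroup ι := if k = z then 1 else of k

/-- The image of the generator `k` under a permutation of the generators other than `z` and the
base point. -/
def permImage (σ : Equiv.Perm ι) (k : ι) : FreeGroup ι :=
  if k = z then of z else (pointed z (σ z))⁻¹ * pointed z (σ k)

/-- The left factor moves the image of the base point back to `1`. The formula also covers `k = z`,
which makes `permImage` multiplicative. -/
theorem lift_permImage_pointed (σ : Equiv.Perm ι) (k : ι) :
    FreeGroup.lift (permImage z σ) (pointed z k) = (pointed z (σ z))⁻¹ * pointed z (σ k) := by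
  by_cases hk : k = z
  · rw [hk, inv_mul_cancel, pointed, if_pos rfl, map_one]
  · conv_lhs => rw [pointed, if_neg hk, FreeGroup.lift_apply_of, permImage, if_neg hk]

/-- The action of the symmetric group on the generators other than `z` and the base point. -/
def permAut : Equiv.Perm ι →* MulAut (FreeGroup ι) :=
  autHom (permImage z)
    (fun k => by by_cases hk : k = z <;> simp [hk, permImage, pointed])
    (fun σ τ k => by
      by_cases hk : k = z
      · simp [hk, permImage]
      · conv_lhs => rw [permImage, if_neg hk, map_mul, map_inv, lift_permImage_pointed,
          lift_permImage_pointed]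
        rw [permImage, if_neg hk, Equiv.Perm.mul_apply, Equiv.Perm.mul_apply]
        group)

/-- The automorphisms `of k ↦ of z ^ u k * of k * of z ^ v k` for `k ≠ z`. -/
def mulAut : Multiplicative ((ι → ℤ) × (ι → ℤ)) →* MulAut (FreeGroup ι) :=
  autHom (fun x k => if k = z then of z else of z ^ x.toAdd.1 k * of k * of z ^ x.toAdd.2 k)
    (fun k => by by_cases hk : k = z <;> simp [hk])
    (fun x y k => by
      by_cases hk : k = z
      · simp [hk]
      · simp only [if_neg hk, map_mul, map_zpow, FreeGroup.lift_apply_of, if_true, toAdd_mul,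
          Prod.fst_add, Prod.snd_add, Pi.add_apply]
        rw [add_comm (x.toAdd.1 k), zpow_add, zpow_add]
        simp only [mul_assoc])

theorem permAut_self (σ : Equiv.Perm ι) : permAut z σ (of z) = of z := by
  rw [permAut, autHom_of, permImage, if_pos rfl]

theorem permAut_pointed (σ : Equiv.Perm ι) (k : ι) :
    permAut z σ (pointed z k) = (pointed z (σ z))⁻¹ * pointed z (σ k) := by
  by_cases hk : k = z
  · rw [hk, inv_mul_cancel, pointed, if_pos rfl, map_one]
  · conv_lhs => rw [pointed, if_neg hk, permAut, autHom_of, permImage, if_neg hk]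

theorem mulAut_self (x : Multiplicative ((ι → ℤ) × (ι → ℤ))) : mulAut z x (of z) = of z := by
  rw [mulAut, autHom_of, if_pos rfl]

theorem mulAut_of_ne {k : ι} (hk : k ≠ z) (u v : ι → ℤ) :
    mulAut z (ofAdd (u, v)) (of k) = of z ^ u k * of k * of z ^ v k := by
  rw [mulAut, autHom_of, if_neg hk]
  rfl

theorem mulAut_congr {u v u' v' : ι → ℤ} (hu : ∀ k ≠ z, u k = u' k) (hv : ∀ k ≠ z, v k = v' k) :
    mulAut z (ofAdd (u, v)) = mulAut z (ofAdd (u', v')) := by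
  refine mulAut_ext fun k => ?_
  by_cases hk : k = z
  · subst hk; rw [mulAut_self, mulAut_self]
  · rw [mulAut_of_ne z hk, mulAut_of_ne z hk, hu k hk, hv k hk]

/-- Every point, the base point included, is multiplied on the right by its power of `z`; the common
left factor restores the base point. -/
theorem mulAut_transHom_pointed (v : ι → ℤ) (k : ι) :
    mulAut z (transHom z (ofAdd v)) (pointed z k) =
      of z ^ (-v z) * pointed z k * of z ^ v k := by
  rw [transHom_ofAdd]
  by_cases hk : k = z
  · subst hk; simp [pointed]
  · rw [pointed, if_neg hk, mulAut_of_ne z hk]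

theorem permAut_mul_trans (σ : Equiv.Perm ι) (v : ι → ℤ) :
    permAut z σ * mulAut z (transHom z (ofAdd v)) =
      mulAut z (transHom z (ofAdd fun c => v (σ.symm c))) * permAut z σ := by
  refine mulAut_ext fun k => ?_
  by_cases hk : k = z
  · subst hk
    rw [MulAut.mul_apply, MulAut.mul_apply, mulAut_self, permAut_self, mulAut_self]
  · have : of k = pointed z k := by rw [pointed, if_neg hk]
    rw [this, MulAut.mul_apply, MulAut.mul_apply, mulAut_transHom_pointed, permAut_pointed,
      map_mul, map_mul, map_mul, map_zpow, map_zpow, permAut_self, permAut_pointed, map_inv,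
      mulAut_transHom_pointed, mulAut_transHom_pointed]
    simp only [Equiv.symm_apply_apply]
    group

/-- The automorphism inverting the generator `j`. -/
def invertGen (j : ι) : MulAut (FreeGroup ι) :=
  MonoidHom.toMulEquiv
    (FreeGroup.lift fun k => if k = j then (of j)⁻¹ else of k)
    (FreeGroup.lift fun k => if k = j then (of j)⁻¹ else of k)
    (by
      ext k
      by_cases hk : k = j <;> simp [hk])
    (by
      ext k
      by_cases hk : k = j <;> simp [hk])

theorem invertGen_of (j k : ι) : invertGen j (of k) = if k = j then (of j)⁻¹ else of k := by
  simp [invertGen]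

/-- Inverting `a_j` exchanges left and right multiplication, with a change of sign. -/
theorem invertGen_conj {j : ι} (hj : j ≠ z) (u v : ι → ℤ) :
    invertGen j * mulAut z (ofAdd (u, v)) * (invertGen j)⁻¹ =
      mulAut z (ofAdd (Function.update u j (-v j), Function.update v j (-u j))) := by
  rw [mul_inv_eq_iff_eq_mul]
  refine mulAut_ext fun k => ?_
  rw [MulAut.mul_apply, MulAut.mul_apply, invertGen_of]
  by_cases hk : k = z
  · subst hk
    rw [if_neg hj.symm, mulAut_self, mulAut_self, invertGen_of, if_neg hj.symm]
  · rw [mulAut_of_ne z hk, map_mul, map_mul, map_zpow, map_zpow, invertGen_of, invertGen_of,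
      if_neg hj.symm]
    by_cases hkj : k = j
    · subst hkj
      rw [if_pos rfl, map_inv, mulAut_of_ne z hk]
      simp only [Function.update_self]
      group
    · rw [if_neg hkj, mulAut_of_ne z hk]
      simp [hkj]

end FreeGroupAut

section Nielsen

open Multiplicative FreeGroupAut

variable {X : Type*} [MetricSpace X] [CompleteSpace X] [Nonempty X]

/-- The vectors whose automorphisms have a fixed point. -/
def fixedVectors (hX : IsCAT0 X) {ι : Type*} [DecidableEq ι]
    [MulAction (MulAut (FreeGroup ι)) X] [IsIsometricSMul (MulAut (FreeGroup ι)) X] (z : ι) :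
    AddSubgroup ((ι → ℤ) × (ι → ℤ)) where
  carrier := {x | HasFixedPoint X (mulAut z (ofAdd x))}
  zero_mem' := by
    obtain ⟨x⟩ := ‹Nonempty X›
    exact ⟨x, by rw [ofAdd_zero, map_one, one_smul]⟩
  add_mem' {x y} hx hy := by
    change HasFixedPoint X (mulAut z (ofAdd (x + y)))
    rw [ofAdd_add, map_mul]
    exact hX.hasFixedPoint_mul ((Commute.all (ofAdd x) (ofAdd y)).map (mulAut z)) hx hy
  neg_mem' {x} hx := by
    change HasFixedPoint X (mulAut z (ofAdd (-x)))
    rw [ofAdd_neg, map_inv]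
    exact HasFixedPoint.inv hx

/-- Differences `(0, e_i - e_j)` never leave the vectors of coordinate sum zero. Conjugation by
inversions and the translation `e_i - e_z`, whose left part is constant, supply the missing
relations. -/
theorem IsCAT0.single_mem_fixedVectors (hX : IsCAT0 X) {k : ℕ} (hk : 2 ≤ k)
    (hdim : HasCoveringDimensionLT X k)
    [MulAction (MulAut (FreeGroup (Fin (k + 1)))) X]
    [IsIsometricSMul (MulAut (FreeGroup (Fin (k + 1)))) X] {z i : Fin (k + 1)} (hi : i ≠ z) :
    (0, Pi.single i 1) ∈ fixedVectors hX z ∧ (Pi.single i 1, 0) ∈ fixedVectors hX z := by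
  set H := fixedVectors hX z with hH
  have hcongr : ∀ {u v : Fin (k + 1) → ℤ} (u' v' : Fin (k + 1) → ℤ), (u', v') ∈ H →
      (∀ c ≠ z, u c = u' c) → (∀ c ≠ z, v c = v' c) → (u, v) ∈ H := by
    intro u v u' v' h hu hv
    change HasFixedPoint X (mulAut z (ofAdd (u, v)))
    rw [mulAut_congr z hu hv]
    exact h
  have htrans : ∀ {i j : Fin (k + 1)}, i ≠ j →
      HasFixedPoint X (mulAut z (transHom z (ofAdd (Pi.single i 1 - Pi.single j 1)))) :=
    fun hij => hX.hasFixedPoint_translation (by omega) hdim (permAut z)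
      ((mulAut z).comp (transHom z)) (fun σ v => permAut_mul_trans z σ v) hij
  have hdiff : ∀ {i j : Fin (k + 1)}, i ≠ z → j ≠ z →
      ((0, Pi.single i 1 - Pi.single j 1) : (Fin (k + 1) → ℤ) × (Fin (k + 1) → ℤ)) ∈ H := by
    intro i j hi hj
    rcases eq_or_ne i j with rfl | hij
    · rw [sub_self]
      exact H.zero_mem
    · refine hcongr _ _ (htrans hij) (fun c _ => ?_) fun _ _ => rfl
      simp [hi.symm, hj.symm]
  have hmix : ∀ {i j : Fin (k + 1)}, i ≠ z → j ≠ z → i ≠ j →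
      ((Pi.single j 1, Pi.single i 1) : (Fin (k + 1) → ℤ) × (Fin (k + 1) → ℤ)) ∈ H := by
    intro i j hi hj hij
    have h := (hdiff hi hj).conj (invertGen j)
    rw [invertGen_conj z hj] at h
    refine hcongr _ _ h (fun c _ => ?_) fun c _ => ?_
    · rcases eq_or_ne c j with rfl | hc
      · simp [hij]
      · simp [hc]
    · rcases eq_or_ne c j with rfl | hc
      · simp [hij.symm]
      · simp [hc]
  have hcard : ∀ i : Fin (k + 1), i ≠ z →
      (Finset.univ \ {i, z} : Finset (Fin (k + 1))).card = k - 1 := by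
    intro i hi
    rw [Finset.card_univ_sdiff, Fintype.card_fin, Finset.card_pair hi]
    omega
  have hthird : ∀ i : Fin (k + 1), i ≠ z → ∃ j, j ≠ i ∧ j ≠ z := by
    intro i hi
    obtain ⟨j, hj⟩ := Finset.card_pos.1 ((hcard i hi).symm ▸ (by omega : 0 < k - 1))
    exact ⟨j, by simpa using hj⟩
  have hrho : ∀ {i : Fin (k + 1)}, i ≠ z →
      ((0, Pi.single i 1) : (Fin (k + 1) → ℤ) × (Fin (k + 1) → ℤ)) ∈ H := by
    intro i hi
    obtain ⟨j, hji, hjz⟩ := hthird i hi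
    have h1 : ((fun _ => 1, Pi.single i 1) : (Fin (k + 1) → ℤ) × (Fin (k + 1) → ℤ)) ∈ H :=
      hcongr _ _ (htrans hi) (fun c _ => by simp [hi]) fun c hc => by simp [hc]
    have h2 := H.sum_mem (t := Finset.univ \ {i, z}) (f := fun c =>
      ((Pi.single c 1, Pi.single i 1) : (Fin (k + 1) → ℤ) × (Fin (k + 1) → ℤ)))
      fun c hc => by
        simp only [Finset.mem_sdiff, Finset.mem_univ, Finset.mem_insert, Finset.mem_singleton,
          not_or, true_and] at hc
        exact hmix hi hc.2 (Ne.symm hc.1)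
    -- Away from `z`, `h2 - h1` is `(-e_i, (k - 2) e_i)`, and the last two vectors add up to `(e_i,
    -- e_i)`.
    have h3 := H.add_mem (H.sub_mem h2 h1) (H.add_mem (hdiff hi hjz) (hmix hjz hi hji))
    have h4 : ((0, Pi.single i ((k : ℤ) - 1)) : (Fin (k + 1) → ℤ) × (Fin (k + 1) → ℤ)) ∈ H := by
      refine hcongr _ _ h3 (fun c hc => ?_) fun c hc => ?_
      · simp only [Prod.fst_add, Prod.fst_sub, Prod.fst_sum, Pi.add_apply, Pi.sub_apply,
          Finset.sum_apply, Pi.zero_apply, Pi.single_apply]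
        rcases eq_or_ne c i with rfl | hci
        · simp
        · simp [hc, hci]
      · simp only [Prod.snd_add, Prod.snd_sub, Prod.snd_sum, Pi.add_apply, Pi.sub_apply,
          Finset.sum_const, hcard i hi, nsmul_eq_mul,
          Nat.cast_sub (by omega : 1 ≤ k)]
        rcases eq_or_ne c i with rfl | hci
        · simp [hji.symm]
        · simp [hci]
    refine hX.hasFixedPoint_of_pow (k := k - 1) (by omega) ?_
    rw [← map_pow, ← ofAdd_nsmul, Prod.smul_mk, smul_zero, ← Pi.single_smul, nsmul_eq_mul,
      mul_one, Nat.cast_sub (by omega), Nat.cast_one]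
    exact h4
  refine ⟨hrho hi, ?_⟩
  obtain ⟨j, hji, hjz⟩ := hthird i hi
  -- `(e_i, e_j) - (0, e_j) = (e_i, 0)`.
  have h := H.sub_mem (hmix hjz hi hji) (hrho hjz)
  simpa using h

theorem IsCAT0.hasFixedPoint_nielsen (hX : IsCAT0 X) {k : ℕ} (hk : 2 ≤ k)
    (hdim : HasCoveringDimensionLT X k)
    [MulAction (MulAut (FreeGroup (Fin (k + 1)))) X]
    [IsIsometricSMul (MulAut (FreeGroup (Fin (k + 1)))) X] {i j : Fin (k + 1)} (hij : i ≠ j) :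
    HasFixedPoint X (nielsenRho i j hij) ∧ HasFixedPoint X (nielsenLambda i j hij) := by
  obtain ⟨h1, h2⟩ := hX.single_mem_fixedVectors hk hdim hij
  have e1 : mulAut j (ofAdd (0, Pi.single i 1)) = nielsenRho i j hij := by
    refine mulAut_ext fun c => ?_
    by_cases hc : c = j
    · subst hc; simp [mulAut_self, nielsenRho, hij.symm]
    · rw [mulAut_of_ne j hc]
      by_cases hci : c = i <;> simp [nielsenRho, hci]
  have e2 : mulAut j (ofAdd (Pi.single i 1, 0)) = nielsenLambda i j hij := by
    refine mulAut_ext fun c => ?_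
    by_cases hc : c = j
    · subst hc; simp [mulAut_self, nielsenLambda, hij.symm]
    · rw [mulAut_of_ne j hc]
      by_cases hci : c = i <;> simp [nielsenLambda, hci]
  exact ⟨e1 ▸ h1, e2 ▸ h2⟩

end Nielsen

theorem mainTheorem7 (n d : ℕ) (hn : 4 ≤ n) (hd : (d : ℤ) < (n : ℤ) - 2)
    (X : Type*) [MetricSpace X] [CompleteSpace X] [Nonempty X]
    (hX : IsCAT0 X) (hdim : coveringDimension X = d)
    [MulAction (MulAut (FreeGroup (Fin n))) X]
    [IsIsometricSMul (MulAut (FreeGroup (Fin n))) X]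
    (i j : Fin n) (hij : i ≠ j) :
    (∃ x : X, nielsenRho i j hij • x = x) ∧ (∃ x : X, nielsenLambda i j hij • x = x) := by
  obtain ⟨k, rfl⟩ : ∃ k, n = k + 1 := ⟨n - 1, by omega⟩
  have h1 : HasCoveringDimensionLT X k :=
    (coveringDimension_le_iff.1 hdim.le).mono (by push_cast at hd; omega)
  exact hX.hasFixedPoint_nielsen (by omega) h1 hij
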